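/- All graphs are finite and simple, and $F$ has at least one vertex; $v(F)$ is the number of vertices of $F$. A copy of $F$ in a graph is a subgraph isomorphic to $F$. Let $\mathrm{ex}_F(n,G)$ denote the maximum number of pairwise edge-disjoint copies of $F$ on an $n$-element vertex set such that no copy of $G$ has its edges in pairwise distinct members of this family of copies of $F$. For a positive integer $s$, the blow-up $F(s)$ is obtained from $F$ by replacing each vertex by an independent set of $s$ vertices and each edge by a complete bipartite graph between the corresponding sets. A graph decomposes into $m$ edge-disjoint copies of $F$ if it has $m$ distinct, pairwise edge-disjoint subgraphs isomorphic to $F$ that together contain all of its edges. Theorem. Let $F,G$ be graphs and let $s$ be a positive integer. 1. If $\mathrm{ex}_F(n,G)=\frac{n^2}{v(F)^2}+o(n^2)$ as $n\to\infty$ and $F(s)$ decomposes into $s^2$ edge-disjoint copies of $F$, then $\mathrm{ex}_{F(s)}(n,G)=\frac{n^2}{v(F(s))^2}+o(n^2)$. 2. Let $s$ be a prime with $v(F)\le s$. If $\mathrm{ex}_F(n,G)=\frac{n^2}{v(F)^2}+o(n^2)$, then $\mathrm{ex}_{F(s)}(n,G)=\frac{n^2}{v(F(s))^2}+o(n^2)$.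 Moreover, if $v(F)\ge 2$ (with no assumption on $\mathrm{ex}_F(n,G)$), then $F(s)$ decomposes into $s^2$ edge-disjoint copies of $F$. More precisely, for every enumeration $v_1,\dots,v_t$ of $V(F)$, identify the set replacing each vertex with $\mathbb Z/s\mathbb Z$; for $x,y\in\mathbb Z/s\mathbb Z$ let $F^{x,y}$ be the copy of $F$ in $F(s)$ that represents $v_1$ by $x$, $v_2$ by $y$, and $v_{i+2}$ by $x+iy$ for $1\le i\le t-2$. Then the $F^{x,y}$ are $s^2$ distinct subgraphs that form such a decomposition. -/

import Mathlib

open Filter Asymptotics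

/-- The `s`-blow-up `F(s)`: each vertex `v` is replaced by the independent set `{v} × Fin s`, and each
edge by a complete bipartite graph. -/
def blowUp {V : Type*} (F : SimpleGraph V) (s : ℕ) : SimpleGraph (V × Fin s) where
  Adj p q := F.Adj p.1 q.1
  symm := ⟨fun _ _ h => h.symm⟩
  loopless := ⟨fun _ h => F.irrefl h⟩

/-- `P` is a set of pairwise edge-disjoint copies of `F` in `H`; a copy is a subgraph isomorphic
to `F`. -/
structure IsPacking {V U : Type*} (F : SimpleGraph V) (H : SimpleGraph U)
    (P : Set H.Subgraph) : Prop where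
  isCopy : ∀ A ∈ P, Nonempty (F ≃g A.coe)
  edgeDisjoint : P.Pairwise fun A B => Disjoint A.edgeSet B.edgeSet

/-- `P` is a decomposition of `H` into copies of `F`: these copies are edge-disjoint, and
every edge of `H` lies in one of them. -/
structure IsDecomposition {V U : Type*} (F : SimpleGraph V) (H : SimpleGraph U)
    (P : Set H.Subgraph) : Prop extends IsPacking F H P where
  covers : ∀ e ∈ H.edgeSet, ∃ A ∈ P, e ∈ A.edgeSet

/-- `H` can be decomposed into exactly `m` edge-disjoint copies of `F`. -/
def DecomposesInto {V U : Type*} (H : SimpleGraph U) (m : ℕ) (F : SimpleGraph V) : Prop :=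
  ∃ P : Set H.Subgraph, P.Finite ∧ P.ncard = m ∧ IsDecomposition F H P

/-- The family `P` contains a rainbow copy of `G`: an injection `f` of the vertices of `G` for which
the images of the edges of `G` lie in pairwise distinct members of `P`. -/
def HasRainbowCopy {W U : Type*} (G : SimpleGraph W) {H : SimpleGraph U}
    (P : Set H.Subgraph) : Prop :=
  ∃ f : W ↪ U, ∃ c : G.edgeSet ↪ P,
    ∀ e : G.edgeSet, Sym2.map f e.1 ∈ (c e).1.edgeSet

/-- The `F`-multicolor Turán number `ex_F(n, G)`: the maximum number of edge-disjoint copies of `F`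
on the vertex set `Fin n` without a rainbow copy of `G`. -/
noncomputable def multicolorTuran {V W : Type*} (F : SimpleGraph V) (G : SimpleGraph W)
    (n : ℕ) : ℕ :=
  sSup {k : ℕ | ∃ P : Set (⊤ : SimpleGraph (Fin n)).Subgraph,
    IsPacking F ⊤ P ∧ ¬ HasRainbowCopy G P ∧ P.ncard = k}

/-- `ex_F(n, G) = n² / v(F)² + o(n²)`. -/
def AttainsLowerBound {V W : Type*} [Fintype V] (F : SimpleGraph V) (G : SimpleGraph W) : Prop :=
  (fun n : ℕ => (multicolorTuran F G n : ℝ) - (n : ℝ) ^ 2 / (Fintype.card V : ℝ) ^ 2)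
    =o[atTop] fun n : ℕ => (n : ℝ) ^ 2

/-- The affine coordinates modulo `s`: `x`, `y`, `x + y`, `x + 2y`, `x + 3y`, … -/
def affineCoord {s : ℕ} (x y : Fin s) : ℕ → Fin s
  | 0 => x
  | 1 => y
  | i + 2 => ⟨(x.val + (i + 1) * y.val) % s, Nat.mod_lt _ x.pos⟩

/-- With the vertices of `F` enumerated by `e`, the copy `F^{x,y}` of `F` in `F(s)` whose vertex in
the part of `v` is given by the affine coordinate with the index of `v`. -/
def affineCopy {V : Type*} [Fintype V] (F : SimpleGraph V) (s : ℕ)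
    (e : V ≃ Fin (Fintype.card V)) (x y : Fin s) : SimpleGraph.Copy F (blowUp F s) where
  toHom := { toFun := fun v => (v, affineCoord x y (e v).val), map_rel' := fun h => h }
  injective' := fun _ _ h => congrArg Prod.fst h

/-- The family of all the copies `F^{x,y}` with `x` and `y` modulo `s`. -/
def affineFamily {V : Type*} [Fintype V] (F : SimpleGraph V) (s : ℕ)
    (e : V ≃ Fin (Fintype.card V)) : Set (blowUp F s).Subgraph :=
  Set.range fun p : Fin s × Fin s => (affineCopy F s e p.1 p.2).toSubgraph

/-! The hypothesis `AttainsLowerBound F G` forces that there is no homomorphism from `G` to `F`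
(`AttainsLowerBound.isEmpty_hom`). Projecting `F(s)` to `F`, there is none from `G` to `F(s)`
either, and this gives the lower bound: for `m` close to `n / v` with `v = v(F(s))`, the `m`-blow-up
of `F(s)`, placed on at most `n` vertices, splits into `m ^ 2` copies of `F(s)`. A rainbow `G` would
map homomorphically into that blow-up and hence into `F(s)`.

For the upper bound, a packing without rainbow `G` has only `O(n ^ (v(G) - 1))` homomorphisms from
`G` to its union, so by the removal lemma dropping `o(n ^ 2)` members destroys them all
(`exists_subpacking_hom_free`). Splitting each remaining copy of `F(s)` into `s ^ 2` copies of `F`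
keeps the union free of homomorphic images of `G`, so `s ^ 2` times the number of remaining copies
is at most `ex_F(n, G)`.

The decomposition of `F(s)` rests on the fact that two affine coordinates determine `(x, y)` when
the differences of indices are invertible modulo `s`. -/

/-! ### Counting homomorphisms through regular pairs. -/

open Finset in
theorem sum_sum_update {W α : Type*} [Fintype W] [DecidableEq W] [Fintype α] (h : (W → α) → ℝ)
    (a : W) :
    ∑ f : W → α, ∑ x : α, h (Function.update f a x) = Fintype.card α * ∑ f : W → α, h f := by
  have h1 : ∑ p : (W → α) × α, h (Function.update p.1 a p.2) = ∑ p : (W → α) × α, h p.1 := by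
    -- Exchanging `x` with the value of `f` at `a` is an involution on the pairs `(f, x)`.
    refine Finset.sum_nbij' (fun p => (Function.update p.1 a p.2, p.1 a))
      (fun p => (Function.update p.1 a p.2, p.1 a)) ?_ ?_ ?_ ?_ ?_ <;> simp
  rw [Fintype.sum_prod_type, Fintype.sum_prod_type] at h1
  rw [h1]
  simp [mul_sum]

open Finset in
/-- An inequality of sums over functions `W → α` may be checked after freeing two coordinates. -/
theorem sum_le_sum_of_update {W α : Type*} [Fintype W] [DecidableEq W] [Fintype α] [Nonempty α]
    (h k : (W → α) → ℝ) (a b : W)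
    (H : ∀ f, ∑ x : α, ∑ y : α, h (Function.update (Function.update f a x) b y) ≤
      ∑ x : α, ∑ y : α, k (Function.update (Function.update f a x) b y)) :
    ∑ f, h f ≤ ∑ f, k f := by
  have key (g : (W → α) → ℝ) :
      ∑ f : W → α, ∑ x : α, ∑ y : α, g (Function.update (Function.update f a x) b y) =
        Fintype.card α * (Fintype.card α * ∑ f, g f) := by
    rw [sum_sum_update (fun f => ∑ y : α, g (Function.update f b y)) a, sum_sum_update g b]
  have h1 := Finset.sum_le_sum fun f (_ : f ∈ univ) => H f
  rw [key, key] at h1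
  have : (0 : ℝ) < Fintype.card α := by exact_mod_cast Fintype.card_pos
  exact le_of_mul_le_mul_left (le_of_mul_le_mul_left h1 this) this

/-- The pair `(A, B)` has density at least `d` up to an error `ε` on all pairs of subsets. -/
def LowerRegular {α : Type*} (H : SimpleGraph α) (d ε : ℝ) (A B : Finset α) : Prop :=
  ∀ S ⊆ A, ∀ T ⊆ B, d * (S.card * T.card) - ε * (A.card * B.card) ≤
    ∑ x ∈ S, ∑ y ∈ T, (open Classical in if H.Adj x y then (1 : ℝ) else 0)

-- If `S` or `T` is below an `ε`-fraction of its side, the left-hand side is nonpositive because `d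
-- ≤ 1`; otherwise uniformity gives density at least `d - ε` between them.
open Finset Classical in
theorem lowerRegular_of_isUniform {α : Type*} {H : SimpleGraph α} {d ε : ℝ} {A B : Finset α}
    (hd : d ≤ 1) (hε : 0 ≤ ε) (hU : H.IsUniform ε A B) (hD : d ≤ H.edgeDensity A B) :
    LowerRegular H d ε A B := by
  intro S hS T hT
  have hcount : ∑ x ∈ S, ∑ y ∈ T, (if H.Adj x y then (1 : ℝ) else 0) = #(H.interedges S T) := by
    rw [← sum_product', SimpleGraph.interedges_def, card_filter]
    push_cast
    rfl
  rw [hcount]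
  have hSA : (#S : ℝ) ≤ #A := by exact_mod_cast card_le_card hS
  have hTB : (#T : ℝ) ≤ #B := by exact_mod_cast card_le_card hT
  have hS0 : (0 : ℝ) ≤ #S := by positivity
  have hT0 : (0 : ℝ) ≤ #T := by positivity
  have hpos : (0 : ℝ) ≤ #(H.interedges S T) := by positivity
  by_cases h1 : (#A : ℝ) * ε ≤ #S
  · by_cases h2 : (#B : ℝ) * ε ≤ #T
    · have h3 := abs_lt.1 (hU hS hT h1 h2)
      have h4 : (H.edgeDensity S T : ℝ) * (#S * #T) = #(H.interedges S T) := by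
        rcases S.eq_empty_or_nonempty with rfl | hSn
        · simp [SimpleGraph.interedges_def]
        rcases T.eq_empty_or_nonempty with rfl | hTn
        · simp [SimpleGraph.interedges_def]
        have := hSn.card_pos
        have := hTn.card_pos
        rw [SimpleGraph.edgeDensity_def]
        push_cast
        field_simp
      have h5 : (#S : ℝ) * #T ≤ #A * #B := by gcongr
      have h6 : (d - ε) * (#S * #T) ≤ (H.edgeDensity S T : ℝ) * (#S * #T) := by
        gcongr
        linarith [h3.1]
      nlinarith
    · have : (#S : ℝ) * #T ≤ #A * (#B * ε) := by
        gcongr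
        exact (not_le.1 h2).le
      have h7 : d * (#S * #T : ℝ) ≤ 1 * (#S * #T) := by gcongr
      nlinarith
  · have : (#S : ℝ) * #T ≤ (#A * ε) * #B := by
      gcongr
      exact (not_le.1 h1).le
    have h7 : d * (#S * #T : ℝ) ≤ 1 * (#S * #T) := by gcongr
    nlinarith

open Finset Classical in
theorem sum_ite_mem_mem {α : Type*} [Fintype α] (S T : Finset α) (r : α → α → Prop) :
    ∑ x : α, ∑ y : α, (if x ∈ S ∧ y ∈ T ∧ r x y then (1 : ℝ) else 0) =
      ∑ x ∈ S, ∑ y ∈ T, (if r x y then (1 : ℝ) else 0) := by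
  simp only [ite_and]
  rw [← Finset.sum_subset (subset_univ S) (fun x _ hx => by simp [hx])]
  refine Finset.sum_congr rfl fun x hx => ?_
  rw [← Finset.sum_subset (subset_univ T) (fun y _ hy => by simp [hy])]
  exact Finset.sum_congr rfl fun y hy => by simp [hx, hy]

open Finset Classical in
/-- Adding an edge of density at least `d` multiplies the number of maps by at least `d`, up to a
small error. -/
theorem counting_step {W α : Type*} [Fintype W] [Fintype α] [Nonempty α] (H : SimpleGraph α)
    (A : W → Finset α) {d ε : ℝ} {E : Finset (Sym2 W)} {a b : W} (he : s(a, b) ∉ E) (hab : a ≠ b)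
    (hreg : LowerRegular H d ε (A a) (A b)) :
    ∑ f : W → α, (d * (if (∀ v, f v ∈ A v) ∧ ∀ e ∈ E, Sym2.map f e ∈ H.edgeSet
        then (1 : ℝ) else 0) - ε * (if ∀ v, f v ∈ A v then (1 : ℝ) else 0)) ≤
      ∑ f : W → α, if (∀ v, f v ∈ A v) ∧ ∀ e ∈ insert s(a, b) E, Sym2.map f e ∈ H.edgeSet
        then (1 : ℝ) else 0 := by
  apply sum_le_sum_of_update _ _ a b
  intro f
  set K : Prop := ∀ v, v ≠ a → v ≠ b → f v ∈ A v with hK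
  -- With all values but those at `a` and `b` fixed, no pair in `E` contains both `a` and `b`. The
  -- constraints therefore separate into `x ∈ S` and `y ∈ T`, and the new edge is counted by
  -- regularity on `S × T`.
  set S : Finset α := {x ∈ A a | ∀ e ∈ E, b ∉ e →
    Sym2.map (Function.update f a x) e ∈ H.edgeSet} with hS
  set T : Finset α := {y ∈ A b | ∀ e ∈ E, a ∉ e →
    Sym2.map (Function.update f b y) e ∈ H.edgeSet} with hT
  have hA (x y : α) : (∀ v, Function.update (Function.update f a x) b y v ∈ A v) ↔
      K ∧ x ∈ A a ∧ y ∈ A b := by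
    constructor
    · intro h
      refine ⟨fun v hva hvb => ?_, ?_, ?_⟩
      · simpa [hva, hvb] using h v
      · simpa [hab] using h a
      · simpa using h b
    · rintro ⟨h1, h2, h3⟩ v
      by_cases hvb : v = b
      · subst hvb; simpa using h3
      by_cases hva : v = a
      · subst hva; simpa [hvb] using h2
      simpa [hva, hvb] using h1 v hva hvb
  have hmapb (x y : α) (e : Sym2 W) (hb : b ∉ e) :
      Sym2.map (Function.update (Function.update f a x) b y) e =
        Sym2.map (Function.update f a x) e := by
    apply Sym2.map_congr
    intro v hv
    rw [Function.update_of_ne]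
    rintro rfl
    exact hb hv
  have hmapa (x y : α) (e : Sym2 W) (ha : a ∉ e) :
      Sym2.map (Function.update (Function.update f a x) b y) e =
        Sym2.map (Function.update f b y) e := by
    rw [Function.update_comm hab]
    apply Sym2.map_congr
    intro v hv
    rw [Function.update_of_ne]
    rintro rfl
    exact ha hv
  have hQ (x y : α) : ((∀ v, Function.update (Function.update f a x) b y v ∈ A v) ∧
      ∀ e ∈ E, Sym2.map (Function.update (Function.update f a x) b y) e ∈ H.edgeSet) ↔
      K ∧ x ∈ S ∧ y ∈ T := by
    rw [hA, hS, hT, mem_filter, mem_filter]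
    constructor
    · rintro ⟨⟨h1, h2, h3⟩, h4⟩
      refine ⟨h1, ⟨h2, fun e heE hb => ?_⟩, h3, fun e heE ha => ?_⟩
      · rw [← hmapb x y e hb]; exact h4 e heE
      · rw [← hmapa x y e ha]; exact h4 e heE
    · rintro ⟨h1, ⟨h2, h4⟩, h3, h5⟩
      refine ⟨⟨h1, h2, h3⟩, fun e heE => ?_⟩
      by_cases hb : b ∈ e
      · have ha : a ∉ e := by
          intro ha
          exact he (((Sym2.mem_and_mem_iff hab).1 ⟨ha, hb⟩) ▸ heE)
        rw [hmapa x y e ha]; exact h5 e heE ha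
      · rw [hmapb x y e hb]; exact h4 e heE hb
  have hQ' (x y : α) : ((∀ v, Function.update (Function.update f a x) b y v ∈ A v) ∧
      ∀ e ∈ insert s(a, b) E,
        Sym2.map (Function.update (Function.update f a x) b y) e ∈ H.edgeSet) ↔
      K ∧ x ∈ S ∧ y ∈ T ∧ H.Adj x y := by
    rw [forall_mem_insert, ← and_assoc, and_right_comm, hQ]
    simp [hab, and_assoc]
  simp only [hQ, hQ']
  simp only [hA]
  by_cases hKt : K
  · have h1 := hreg S (filter_subset _ _) T (filter_subset _ _)
    have h2 : ∑ x : α, ∑ y : α, (d * (if x ∈ S ∧ y ∈ T then (1 : ℝ) else 0) -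
        ε * (if x ∈ A a ∧ y ∈ A b then (1 : ℝ) else 0)) =
        d * (#S * #T) - ε * (#(A a) * #(A b)) := by
      have aux (S T : Finset α) :
          ∑ x : α, ∑ y : α, (if x ∈ S ∧ y ∈ T then (1 : ℝ) else 0) = #S * #T := by
        simp [ite_and]
      simp only [sum_sub_distrib, ← mul_sum, aux]
    simp only [hKt, true_and]
    rw [h2, sum_ite_mem_mem]
    exact h1
  · simp [hKt]

open Finset Classical in
/-- Counting lemma: the number of maps into the sets `A v` sending a set `E` of pairs to edges. -/
theorem counting_lemma {W α : Type*} [Fintype W] [Fintype α] [Nonempty α] (H : SimpleGraph α)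
    (A : W → Finset α) {d ε : ℝ} (hd0 : 0 ≤ d) (hd1 : d ≤ 1) (hε : 0 ≤ ε) (E : Finset (Sym2 W))
    (hE : ∀ a b, s(a, b) ∈ E → a ≠ b ∧ LowerRegular H d ε (A a) (A b)) :
    (d ^ #E - ε * #E) * ∏ v, (#(A v) : ℝ) ≤
      ∑ f : W → α,
        if (∀ v, f v ∈ A v) ∧ ∀ e ∈ E, Sym2.map f e ∈ H.edgeSet then (1 : ℝ) else 0 := by
  have hcardA : ∑ f : W → α, (if ∀ v, f v ∈ A v then (1 : ℝ) else 0) = ∏ v, (#(A v) : ℝ) := by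
    rw [← Nat.cast_prod, ← Fintype.card_piFinset, ← sum_filter, sum_const, nsmul_one]
    congr 2
    ext f
    simp
  induction E using Finset.induction_on with
  | empty => simp [hcardA]
  | insert e E he ih =>
    have ih := ih fun a b hab => hE a b (mem_insert_of_mem hab)
    rw [card_insert_of_notMem he]
    induction e using Sym2.ind with
    | _ a b =>
    obtain ⟨hab, hreg⟩ := hE a b (mem_insert_self _ _)
    have hstep := counting_step H A he hab hreg
    rw [sum_sub_distrib, ← mul_sum, ← mul_sum, hcardA] at hstep
    refine le_trans ?_ hstep
    have hP : (0 : ℝ) ≤ ∏ v, (#(A v) : ℝ) := Finset.prod_nonneg fun _ _ => Nat.cast_nonneg _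
    have h1 := mul_le_mul_of_nonneg_left ih hd0
    have h2 : d * (ε * #E * ∏ v, (#(A v) : ℝ)) ≤ 1 * (ε * #E * ∏ v, (#(A v) : ℝ)) :=
      mul_le_mul_of_nonneg_right hd1 (mul_nonneg (mul_nonneg hε (Nat.cast_nonneg _)) hP)
    generalize (∑ f : W → α, if (∀ v, f v ∈ A v) ∧ ∀ e ∈ E, Sym2.map f e ∈ H.edgeSet
      then (1 : ℝ) else 0) = N at h1 ⊢
    generalize ∏ v, (#(A v) : ℝ) = Q at *
    push_cast
    rw [pow_succ]
    linarith

/-! ### The removal lemma for homomorphisms. -/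

-- A lost edge lies in a non-uniform pair, inside a part, or in a sparse pair; the three terms bound
-- these in turn.
open Finset Classical in
theorem Finpartition.card_unreduced_le {α : Type*} [Fintype α] [Nonempty α]
    {H : SimpleGraph α} {P : Finpartition (univ : Finset α)} {ε η d : ℝ} (hε : 0 < ε) (hη : 0 < η)
    (hd : 0 ≤ d) (hP : P.IsEquipartition) (hPη : P.IsUniform H η) (hP' : 4 / ε ≤ #P.parts) :
    (#{p : α × α | H.Adj p.1 p.2 ∧ ¬ (H.regularityReduced P η d).Adj p.1 p.2} : ℝ) ≤
      (4 * η + ε / 2 + 4 * d) * (Fintype.card α : ℝ) ^ 2 := by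
  have hsub : ({p : α × α | H.Adj p.1 p.2 ∧ ¬ (H.regularityReduced P η d).Adj p.1 p.2} :
      Finset (α × α)) ⊆
      (P.nonUniforms H η).biUnion (fun (U, V) ↦ U ×ˢ V) ∪ P.parts.biUnion offDiag ∪
        (P.sparsePairs H d).biUnion fun (U, V) ↦ H.interedges U V := by
    rintro ⟨x, y⟩
    simp only [mem_filter, SimpleGraph.regularityReduced_adj, not_and, not_exists, mem_univ,
      true_and, not_le, mem_biUnion, mem_union, mem_product, Prod.exists, mem_offDiag, and_imp,
      or_assoc, and_assoc, P.mk_mem_nonUniforms, Finpartition.mk_mem_sparsePairs,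
      SimpleGraph.mem_interedges_iff]
    intro h h'
    replace h' := h' h
    obtain ⟨U, hU, hx⟩ := P.exists_mem (mem_univ x)
    obtain ⟨V, hV, hy⟩ := P.exists_mem (mem_univ y)
    obtain rfl | hUV := eq_or_ne U V
    · exact Or.inr (Or.inl ⟨U, hU, hx, hy, H.ne_of_adj h⟩)
    by_cases h₂ : H.IsUniform η U V
    · exact Or.inr <| Or.inr ⟨U, V, hU, hV, hUV, h' _ hU _ hV hx hy hUV h₂, hx, hy, h⟩
    · exact Or.inl ⟨U, V, hU, hV, hUV, h₂, hx, hy⟩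
  have h1 := card_le_card hsub
  have h2 := h1.trans ((card_union_le _ _).trans (Nat.add_le_add_right (card_union_le _ _) _))
  have h3 := hP.sum_nonUniforms_lt univ_nonempty hη hPη
  have h4 := hP.card_biUnion_offDiag_le hε hP'
  have h5 := hP.card_interedges_sparsePairs_le (G := H) hd
  rw [card_univ] at h3 h4 h5
  have h6 : (#{p : α × α | H.Adj p.1 p.2 ∧ ¬ (H.regularityReduced P η d).Adj p.1 p.2} : ℝ) ≤
      #((P.nonUniforms H η).biUnion fun (U, V) ↦ U ×ˢ V) + #(P.parts.biUnion offDiag) +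
        #((P.sparsePairs H d).biUnion fun (U, V) ↦ H.interedges U V) := by exact_mod_cast h2
  linarith

open Finset Classical in
theorem Finpartition.IsEquipartition.card_div_le {α : Type*} [Fintype α]
    {P : Finpartition (univ : Finset α)} (hP : P.IsEquipartition) {M : ℕ} (hM : #P.parts ≤ M)
    {U : Finset α} (hU : U ∈ P.parts) : (Fintype.card α : ℝ) / (2 * M) ≤ #U := by
  have hk : 0 < #P.parts := Finset.card_pos.2 ⟨_, hU⟩
  have h1 := hP.average_le_card_part hU
  have hU1 : 1 ≤ #U := (P.nonempty_of_mem_parts hU).card_pos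
  rw [card_univ] at h1
  -- Since `#U ≥ 1`, replacing `#U + 1` by `2 * #U` absorbs the rounding; this is the factor 2 in
  -- the bound.
  have h2 : Fintype.card α < #P.parts * (#U + 1) :=
    (Nat.div_lt_iff_lt_mul hk).1 (Nat.lt_succ_of_le h1) |>.trans_eq (mul_comm _ _)
  have h3 : Fintype.card α ≤ #U * (2 * M) := by nlinarith
  rw [div_le_iff₀ (by have := hk.trans_le hM; positivity)]
  exact_mod_cast h3

open Finset Classical in
/-- Removal lemma for homomorphisms: a graph with few homomorphisms from `G` has none after the
deletion of few edges. -/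
theorem hom_removal {W : Type*} [Fintype W] (G : SimpleGraph W) {ε : ℝ} (hε : 0 < ε) :
    ∃ δ : ℝ, 0 < δ ∧ ∃ N : ℕ, ∀ (α : Type) [Fintype α], N ≤ Fintype.card α →
      ∀ H : SimpleGraph α,
        (#{f : W → α | ∀ e ∈ G.edgeSet, Sym2.map f e ∈ H.edgeSet} : ℝ) <
          δ * (Fintype.card α : ℝ) ^ Fintype.card W →
        ∃ H' ≤ H, IsEmpty (G →g H') ∧
          (#{p : α × α | H.Adj p.1 p.2 ∧ ¬ H'.Adj p.1 p.2} : ℝ) ≤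
            ε * (Fintype.card α : ℝ) ^ 2 := by
  wlog hε1 : ε ≤ 1 generalizing ε
  · obtain ⟨δ, hδ, N, h⟩ := this one_pos le_rfl
    refine ⟨δ, hδ, N, fun α _ hN H hH => ?_⟩
    obtain ⟨H', h1, h2, h3⟩ := h α hN H hH
    exact ⟨H', h1, h2, h3.trans (by gcongr; exact (not_le.1 hε1).le)⟩
  set k := #G.edgeFinset with hk
  -- The deleted fraction is `4 * η + ε / 4 + 4 * d ≤ ε`. The other bound on `η` keeps the total
  -- error `η * k` of the counting lemma below `d ^ k / 2`.
  set d := ε / 8 with hd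
  have hd0 : 0 < d := by positivity
  set η := min (d ^ k / (2 * (k + 1))) (ε / 16) with hη
  have hη0 : 0 < η := by positivity
  set l := ⌈4 / (ε / 2)⌉₊ with hl
  set M := SzemerediRegularity.bound η l with hM
  have hM0 : 0 < M := SzemerediRegularity.bound_pos _ _
  refine ⟨d ^ k / 2 * (1 / (2 * M)) ^ Fintype.card W, by positivity, max l 1,
    fun α _ hN H hH => ?_⟩
  have : Nonempty α := Fintype.card_pos_iff.1 ((le_max_right _ _).trans hN)
  obtain ⟨P, hP1, hP2, hP3, hP4⟩ := szemeredi_regularity H hη0 ((le_max_left _ _).trans hN)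
  refine ⟨H.regularityReduced P η d, SimpleGraph.regularityReduced_le, ⟨fun φ => ?_⟩, ?_⟩
  -- A single homomorphism to the reduced graph selects a part for each vertex of `G`, adjacent
  -- vertices receiving dense uniform pairs. Counting maps into these parts produces too many
  -- homomorphisms to `H`.
  · have hreg : ∀ a b, s(a, b) ∈ G.edgeFinset →
        a ≠ b ∧ LowerRegular H d η (P.part (φ a)) (P.part (φ b)) := by
      intro a b hab
      rw [SimpleGraph.mem_edgeFinset, SimpleGraph.mem_edgeSet] at hab
      refine ⟨hab.ne, ?_⟩
      obtain ⟨-, U, hU, V, hV, hUa, hVb, -, hUV, hD⟩ := φ.map_adj hab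
      rw [P.part_eq_of_mem hU hUa, P.part_eq_of_mem hV hVb]
      exact lowerRegular_of_isUniform (by linarith) hη0.le hUV hD
    have hc := counting_lemma H (fun v => P.part (φ v)) hd0.le (by linarith) hη0.le _ hreg
    have h1 : ∏ _v : W, ((Fintype.card α : ℝ) / (2 * M)) ≤ ∏ v, (#(P.part (φ v)) : ℝ) := by
      apply Finset.prod_le_prod
      · intros; positivity
      · intro v _
        exact hP1.card_div_le hP3 (P.part_mem.2 (mem_univ _))
    rw [prod_const, card_univ] at h1
    have h2 : d ^ k / 2 ≤ d ^ k - η * k := by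
      have : η * k ≤ d ^ k / (2 * (k + 1)) * (k + 1) := by
        gcongr
        · exact min_le_left _ _
        · linarith
      have h3 : d ^ k / (2 * (k + 1)) * (k + 1) = d ^ k / 2 := by field_simp
      linarith
    have h3 : d ^ k / 2 * ((Fintype.card α : ℝ) / (2 * M)) ^ Fintype.card W ≤
        (d ^ k - η * k) * ∏ v, (#(P.part (φ v)) : ℝ) :=
      mul_le_mul h2 h1 (by positivity) ((by positivity : (0 : ℝ) ≤ d ^ k / 2).trans h2)
    have h4 : (∑ f : W → α, if (∀ v, f v ∈ P.part (φ v)) ∧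
        ∀ e ∈ G.edgeFinset, Sym2.map f e ∈ H.edgeSet then (1 : ℝ) else 0) ≤
        #{f : W → α | ∀ e ∈ G.edgeSet, Sym2.map f e ∈ H.edgeSet} := by
      rw [← sum_filter, sum_const, nsmul_one, Nat.cast_le]
      apply card_le_card
      intro f
      simp +contextual
    refine (h3.trans (hc.trans h4)).not_gt (hH.trans_eq ?_)
    rw [div_eq_mul_one_div (Fintype.card α : ℝ), mul_pow]
    ring
  · have h := Finpartition.card_unreduced_le (ε := ε / 2) (by positivity) hη0 hd0.le hP1 hP4
      ((Nat.le_ceil _).trans (by exact_mod_cast hP2))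
    refine (le_of_eq ?_).trans (h.trans ?_)
    · congr!
    · gcongr
      have : η ≤ ε / 16 := min_le_right _ _
      linarith

/-! ### From rainbow-free packings to homomorphism-free ones. -/

theorem IsPacking.eq_of_adj {V U : Type*} {F : SimpleGraph V} {H : SimpleGraph U}
    {P : Set H.Subgraph} (hP : IsPacking F H P) {A B : H.Subgraph} (hA : A ∈ P) (hB : B ∈ P)
    {u v : U} (hAuv : A.Adj u v) (hBuv : B.Adj u v) : A = B := by
  by_contra hne
  exact Set.disjoint_left.1 (hP.edgeDisjoint hA hB hne)
    (SimpleGraph.Subgraph.mem_edgeSet.2 hAuv) (SimpleGraph.Subgraph.mem_edgeSet.2 hBuv)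

/-- The union of a family of subgraphs, as a graph. -/
def unionGraph {U : Type*} {H : SimpleGraph U} (P : Set H.Subgraph) : SimpleGraph U where
  Adj u v := ∃ A ∈ P, A.Adj u v
  symm := ⟨fun _ _ ⟨A, hA, h⟩ => ⟨A, hA, h.symm⟩⟩
  loopless := ⟨fun _ ⟨_, _, h⟩ => h.ne rfl⟩

open Finset Classical in
theorem card_mul_card_le_of_coordinate {W α : Type*} [Fintype W] [Fintype α] (c : W)
    (B : (W → α) → Finset α) (hB : ∀ f x, B (Function.update f c x) = B f) {K : ℕ}
    (hK : ∀ f, #(B f) ≤ K) :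
    #{f : W → α | f c ∈ B f} * Fintype.card α ≤ K * Fintype.card α ^ Fintype.card W := by
  have h1 := sum_sum_update (fun f : W → α => if f c ∈ B f then (1 : ℝ) else 0) c
  simp only [hB, Function.update_self] at h1
  have h2 : ∑ f : W → α, ∑ x : α, (if x ∈ B f then (1 : ℝ) else 0) ≤
      ∑ _f : W → α, (K : ℝ) := by
    refine Finset.sum_le_sum fun f _ => ?_
    simpa using hK f
  rw [h1, ← sum_filter, sum_const, sum_const, nsmul_one, card_univ, Fintype.card_fun,
    nsmul_eq_mul] at h2
  have h3 : Fintype.card α * #{f : W → α | f c ∈ B f} ≤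
    Fintype.card α ^ Fintype.card W * K := by exact_mod_cast h2
  linarith

open Finset Classical in
/-- Without a rainbow copy of `G`, there are few homomorphisms from `G` to the union. -/
theorem IsPacking.card_hom_le {V W α : Type*} [Fintype V] [Fintype W] [Fintype α]
    {F : SimpleGraph V} {G : SimpleGraph W} {H : SimpleGraph α} {P : Set H.Subgraph}
    (hP : IsPacking F H P) (hG : ¬ HasRainbowCopy G P) :
    #{f : W → α | ∀ e ∈ G.edgeSet, Sym2.map f e ∈ (unionGraph P).edgeSet} * Fintype.card α ≤
      Fintype.card W ^ 3 * (Fintype.card V + 1) * Fintype.card α ^ Fintype.card W := by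
  -- By edge-disjointness at most one member contains the edge `xy`, so `bad x y` is its vertex set
  -- or empty.
  set bad : α → α → Finset α :=
    fun x y => {z | ∃ A ∈ P, A.Adj x y ∧ z ∈ A.verts} with hbad
  have hbad_card (x y : α) : #(bad x y) ≤ Fintype.card V := by
    by_cases h : ∃ A ∈ P, A.Adj x y
    · obtain ⟨A, hA, hxy⟩ := h
      obtain ⟨φ⟩ := hP.isCopy A hA
      have hsub : bad x y ⊆ univ.image fun v => (φ v : α) := by
        intro z hz
        obtain ⟨B, hB, hB1, hB2⟩ := (mem_filter.1 hz).2
        obtain rfl := hP.eq_of_adj hA hB hxy hB1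
        exact mem_image.2 ⟨φ.symm ⟨z, hB2⟩, mem_univ _, by simp⟩
      exact (card_le_card hsub).trans (card_image_le.trans card_univ.le)
    · have : bad x y = ∅ := by
        rw [hbad, filter_eq_empty_iff]
        rintro z - ⟨A, hA, hxy, -⟩
        exact h ⟨A, hA, hxy⟩
      simp [this]
  -- A homomorphism that is not a rainbow copy has a triple `(a, b, z)` with `z ≠ a, b` such that `f
  -- z = f a` or `f z` lies in the member containing the edge `f a f b`. Given the other values,
  -- this leaves at most `v(F) + 1` choices for `f z`.
  set B : W × W × W → (W → α) → Finset α := fun p f =>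
    if p.2.2 ≠ p.1 ∧ p.2.2 ≠ p.2.1 then insert (f p.1) (bad (f p.1) (f p.2.1)) else ∅ with hBdef
  have hsub : ({f : W → α | ∀ e ∈ G.edgeSet, Sym2.map f e ∈ (unionGraph P).edgeSet} :
      Finset (W → α)) ⊆ univ.biUnion fun p : W × W × W => {f : W → α | f p.2.2 ∈ B p f} := by
    intro f hf
    replace hf := (mem_filter.1 hf).2
    simp only [mem_biUnion, mem_univ, true_and, mem_filter]
    by_contra! hno
    have hinj : Function.Injective f := by
      intro a c hac
      by_contra hne
      have := hno (a, a, c)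
      simp [hBdef, Ne.symm hne, hac] at this
    have hex : ∀ e : G.edgeSet, ∃ A : P, Sym2.map f e.1 ∈ A.1.edgeSet := by
      rintro ⟨e, he⟩
      have := hf e he
      induction e using Sym2.ind with
      | _ a b =>
      obtain ⟨A, hA, hab⟩ := this
      exact ⟨⟨A, hA⟩, hab⟩
    choose c hc using hex
    refine hG ⟨⟨f, hinj⟩, ⟨c, ?_⟩, hc⟩
    rintro ⟨e, he⟩ ⟨e', he'⟩ hcc
    by_contra hne
    have h1 := hc ⟨e, he⟩
    have h2 := hc ⟨e', he'⟩
    rw [← hcc] at h2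
    generalize c ⟨e, he⟩ = A at h1 h2
    replace hne : e ≠ e' := fun h => hne (Subtype.ext h)
    induction e using Sym2.ind with
    | _ a b =>
    induction e' using Sym2.ind with
    | _ a' b' =>
    have hab' : A.1.Adj (f a') (f b') := h2
    -- Two distinct edges of `G` in one member `A` would give an endpoint of the second outside the
    -- first whose image is a vertex of `A`, which is excluded.
    have key (z : W) (hza : z ≠ a) (hzb : z ≠ b) (hz : f z ∈ A.1.verts) : False := by
      refine hno (a, b, z) ?_
      simp only [hBdef, hza, hzb, ne_eq, not_false_eq_true, and_self, if_true, mem_insert]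
      right
      exact mem_filter.2 ⟨mem_univ _, A.1, A.2, h1, hz⟩
    have ha' : a' = a ∨ a' = b := by
      by_contra! h
      exact key a' h.1 h.2 (A.1.edge_vert hab')
    have hb' : b' = a ∨ b' = b := by
      by_contra! h
      exact key b' h.1 h.2 (A.1.edge_vert hab'.symm)
    have hn : a' ≠ b' := (SimpleGraph.mem_edgeSet _).1 he' |>.ne
    apply hne
    rw [Sym2.eq_iff]
    rcases ha' with rfl | rfl <;> rcases hb' with rfl | rfl <;> simp_all
  have hcount (p : W × W × W) : #{f : W → α | f p.2.2 ∈ B p f} * Fintype.card α ≤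
      (Fintype.card V + 1) * Fintype.card α ^ Fintype.card W := by
    apply card_mul_card_le_of_coordinate
    · intro f x
      by_cases h : p.2.2 ≠ p.1 ∧ p.2.2 ≠ p.2.1
      · simp only [hBdef, h.1.symm, h.2.symm, ne_eq, not_false_eq_true, Function.update_of_ne]
      · simp only [hBdef, h, if_false]
    · intro f
      by_cases h : p.2.2 ≠ p.1 ∧ p.2.2 ≠ p.2.1
      · simp only [hBdef, h, if_true, ne_eq, not_false_eq_true, and_self]
        exact (card_insert_le _ _).trans (Nat.add_le_add_right (hbad_card _ _) 1)
      · simp [hBdef, h]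
  calc _ ≤ (∑ p : W × W × W, #{f : W → α | f p.2.2 ∈ B p f}) * Fintype.card α := by
        gcongr
        exact (card_le_card hsub).trans card_biUnion_le
    _ = ∑ p : W × W × W, #{f : W → α | f p.2.2 ∈ B p f} * Fintype.card α := sum_mul _ _ _
    _ ≤ ∑ _p : W × W × W, (Fintype.card V + 1) * Fintype.card α ^ Fintype.card W :=
        Finset.sum_le_sum fun p _ => hcount p
    _ = _ := by
        rw [sum_const, card_univ, smul_eq_mul, Fintype.card_prod, Fintype.card_prod]
        ring

open Finset Classical in
/-- Deleting few members of a packing without rainbow copy of `G`, one can destroy all the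
homomorphisms from `G` to the union. -/
theorem exists_subpacking_hom_free {V W : Type*} [Fintype V] [Fintype W] (F : SimpleGraph V)
    (G : SimpleGraph W) {ε : ℝ} (hε : 0 < ε) :
    ∀ᶠ n : ℕ in atTop, ∀ P : Set (⊤ : SimpleGraph (Fin n)).Subgraph, IsPacking F ⊤ P →
      ¬ HasRainbowCopy G P → ∃ P' ⊆ P, IsEmpty (G →g unionGraph P') ∧
        (P.ncard : ℝ) ≤ P'.ncard + ε * (n : ℝ) ^ 2 := by
  obtain ⟨δ, hδ, N, hrem⟩ := hom_removal G hε
  set C : ℕ := Fintype.card W ^ 3 * (Fintype.card V + 1) with hC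
  filter_upwards [eventually_ge_atTop N, eventually_gt_atTop 0,
    tendsto_natCast_atTop_atTop.eventually_gt_atTop ((C : ℝ) / δ)] with n hN hn0 hn P hP hG
  have hn0' : (0 : ℝ) < n := by exact_mod_cast hn0
  have hcount := hP.card_hom_le hG
  rw [Fintype.card_fin] at hcount
  have hlt : (#{f : W → Fin n | ∀ e ∈ G.edgeSet, Sym2.map f e ∈ (unionGraph P).edgeSet} : ℝ) <
      δ * (Fintype.card (Fin n) : ℝ) ^ Fintype.card W := by
    rw [Fintype.card_fin]
    refine lt_of_mul_lt_mul_right (a := (n : ℝ)) ?_ hn0'.le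
    have h1 : (#{f : W → Fin n | ∀ e ∈ G.edgeSet, Sym2.map f e ∈ (unionGraph P).edgeSet} : ℝ) * n
      ≤ C * (n : ℝ) ^ Fintype.card W := by exact_mod_cast hcount
    rw [div_lt_iff₀ hδ] at hn
    refine h1.trans_lt ?_
    have : (0 : ℝ) < (n : ℝ) ^ Fintype.card W := by positivity
    nlinarith
  obtain ⟨H', -, hH', hcard⟩ := hrem (Fin n) (by simpa using hN) (unionGraph P) hlt
  rw [Fintype.card_fin] at hcard
  -- The members that survive removal intact. Each other member has lost an edge, and
  -- edge-disjointness makes the choice of such an edge injective.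
  set P' : Set (⊤ : SimpleGraph (Fin n)).Subgraph :=
    {A | A ∈ P ∧ ∀ u v, A.Adj u v → H'.Adj u v} with hP'
  refine ⟨P', fun A hA => hA.1, ⟨fun φ => hH'.false ⟨φ, fun h => ?_⟩⟩, ?_⟩
  · obtain ⟨A, hA, hAadj⟩ := φ.map_rel h
    exact hA.2 _ _ hAadj
  have hex : ∀ A : (⊤ : SimpleGraph (Fin n)).Subgraph, ∃ p : Fin n × Fin n, A ∈ P \ P' →
      A.Adj p.1 p.2 ∧ ¬ H'.Adj p.1 p.2 := by
    intro A
    by_cases hA : A ∈ P \ P'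
    · have : ¬ ∀ u v, A.Adj u v → H'.Adj u v := fun h => hA.2 ⟨hA.1, h⟩
      push Not at this
      obtain ⟨u, v, h⟩ := this
      exact ⟨(u, v), fun _ => h⟩
    · exact ⟨(⟨0, hn0⟩, ⟨0, hn0⟩), fun h => absurd h hA⟩
  choose g hg using hex
  have hdiff : (P \ P').ncard ≤
      #{p : Fin n × Fin n | (unionGraph P).Adj p.1 p.2 ∧ ¬ H'.Adj p.1 p.2} := by
    rw [← Set.ncard_coe_finset]
    refine Set.ncard_le_ncard_of_injOn g ?_ ?_ (Set.toFinite _)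
    · intro A hA
      rw [mem_coe, mem_filter]
      exact ⟨mem_univ _, ⟨A, hA.1, (hg A hA).1⟩, (hg A hA).2⟩
    · intro A hA B hB hAB
      have h1 := (hg A hA).1
      rw [hAB] at h1
      exact hP.eq_of_adj hA.1 hB.1 h1 (hg B hB).1
  have hle : P.ncard ≤ P'.ncard + (P \ P').ncard := by
    rw [add_comm]
    exact (Set.ncard_sdiff_add_ncard_of_subset (fun A hA => hA.1) (Set.toFinite _)).ge
  have h1 : (P.ncard : ℝ) ≤ P'.ncard + (P \ P').ncard := by exact_mod_cast hle
  have h2 : ((P \ P').ncard : ℝ) ≤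
      #{p : Fin n × Fin n | (unionGraph P).Adj p.1 p.2 ∧ ¬ H'.Adj p.1 p.2} := by
    exact_mod_cast hdiff
  linarith

/-! ### The affine decomposition of the blow-up. -/

theorem affineCoord_cast {s : ℕ} (x y : Fin s) (i : ℕ) :
    ((affineCoord x y (i + 2)).val : ZMod s) = (x.val : ZMod s) + (i + 1) * (y.val : ZMod s) := by
  simp [affineCoord]

theorem Fin.ext_of_cast_zmod {s : ℕ} {x y : Fin s} (h : (x.val : ZMod s) = (y.val : ZMod s)) :
    x = y := by
  rw [ZMod.natCast_eq_natCast_iff] at h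
  exact Fin.ext (Nat.ModEq.eq_of_lt_of_lt h x.2 y.2)

/-- Two affine coordinates determine `x` and `y` if the small numbers are invertible modulo `s`. -/
theorem affineCoord_injective {s t : ℕ} (hs : ∀ k, 0 < k → k < t → k.Coprime s) {i j : ℕ}
    (hij : i < j) (hj : j < t) {x y x' y' : Fin s}
    (h1 : affineCoord x y i = affineCoord x' y' i) (h2 : affineCoord x y j = affineCoord x' y' j) :
    x = x' ∧ y = y' := by
  have hunit (k : ℕ) (hk : 0 < k) (hkt : k < t) {a b : ZMod s} (h : (k : ZMod s) * a = k * b) :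
      a = b := ((ZMod.isUnit_iff_coprime k s).2 (hs k hk hkt)).mul_left_cancel h
  match i, j, hij with
  | 0, 1, _ => exact ⟨h1, h2⟩
  | 0, j + 2, _ =>
    obtain rfl : x = x' := h1
    have h := congrArg (fun z : Fin s => (z.val : ZMod s)) h2
    simp only [affineCoord_cast] at h
    refine ⟨rfl, Fin.ext_of_cast_zmod (hunit (j + 1) (by omega) (by omega) ?_)⟩
    push_cast
    exact add_left_cancel h
  | 1, j + 2, _ =>
    obtain rfl : y = y' := h1
    have h := congrArg (fun z : Fin s => (z.val : ZMod s)) h2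
    simp only [affineCoord_cast] at h
    exact ⟨Fin.ext_of_cast_zmod (add_right_cancel h), rfl⟩
  | i + 2, j + 2, hij =>
    have h := congrArg (fun z : Fin s => (z.val : ZMod s)) h2
    have h' := congrArg (fun z : Fin s => (z.val : ZMod s)) h1
    simp only [affineCoord_cast] at h h'
    -- Subtracting the two equations eliminates `x` and leaves `y` with coefficient `k = j - i`.
    obtain ⟨k, rfl⟩ : ∃ k, j = i + k := ⟨j - i, by omega⟩
    obtain rfl : y = y' := by
      refine Fin.ext_of_cast_zmod (hunit k (by omega) (by omega) ?_)
      push_cast at h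
      linear_combination h - h'
    exact ⟨Fin.ext_of_cast_zmod (add_right_cancel h'), rfl⟩

theorem affineCoord_injective_of_ne {s t : ℕ} (hs : ∀ k, 0 < k → k < t → k.Coprime s) {i j : ℕ}
    (hij : i ≠ j) (hi : i < t) (hj : j < t) {p q : Fin s × Fin s}
    (h1 : affineCoord p.1 p.2 i = affineCoord q.1 q.2 i)
    (h2 : affineCoord p.1 p.2 j = affineCoord q.1 q.2 j) : p = q := by
  rcases lt_or_gt_of_ne hij with h | h
  · exact Prod.ext_iff.2 (affineCoord_injective hs h hj h1 h2)
  · exact Prod.ext_iff.2 (affineCoord_injective hs h hi h2 h1)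

theorem affineCopy_toSubgraph_adj {V : Type*} [Fintype V] {F : SimpleGraph V} {s : ℕ}
    {e : V ≃ Fin (Fintype.card V)} {p : Fin s × Fin s} {a b : V × Fin s} :
    (affineCopy F s e p.1 p.2).toSubgraph.Adj a b ↔ F.Adj a.1 b.1 ∧
      affineCoord p.1 p.2 (e a.1) = a.2 ∧ affineCoord p.1 p.2 (e b.1) = b.2 := by
  obtain ⟨u, i⟩ := a
  obtain ⟨v, j⟩ := b
  simp only [SimpleGraph.Copy.toSubgraph, SimpleGraph.Subgraph.map_adj, Relation.Map,
    SimpleGraph.Subgraph.top_adj]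
  constructor
  · rintro ⟨u', v', h, hu, hv⟩
    obtain ⟨rfl, rfl⟩ := Prod.ext_iff.1 hu
    obtain ⟨rfl, rfl⟩ := Prod.ext_iff.1 hv
    exact ⟨h, rfl, rfl⟩
  · rintro ⟨h, rfl, rfl⟩
    exact ⟨u, v, h, rfl, rfl⟩

/-- The vertices in the first two parts are `x` and `y` themselves, hence the need for two vertices
in `F`. -/
theorem affineCopy_toSubgraph_injective {V : Type*} [Fintype V] (F : SimpleGraph V) {s : ℕ}
    (hV : 2 ≤ Fintype.card V) (hs : ∀ k, 0 < k → k < Fintype.card V → k.Coprime s)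
    (e : V ≃ Fin (Fintype.card V)) :
    Function.Injective fun p : Fin s × Fin s => (affineCopy F s e p.1 p.2).toSubgraph := by
  intro p q hpq
  have hverts (v : V) : affineCoord p.1 p.2 (e v) = affineCoord q.1 q.2 (e v) := by
    have h : (v, affineCoord p.1 p.2 (e v)) ∈ (affineCopy F s e p.1 p.2).toSubgraph.verts :=
      ⟨v, trivial, rfl⟩
    rw [show (affineCopy F s e p.1 p.2).toSubgraph = (affineCopy F s e q.1 q.2).toSubgraph
      from hpq] at h
    obtain ⟨w, -, hw⟩ := h
    obtain ⟨rfl, hw⟩ := Prod.ext_iff.1 hw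
    exact hw.symm
  have h0 := hverts (e.symm ⟨0, by omega⟩)
  have h1 := hverts (e.symm ⟨1, by omega⟩)
  rw [e.apply_symm_apply] at h0 h1
  exact affineCoord_injective_of_ne hs zero_ne_one (by omega) hV h0 h1

theorem affineFamily_ncard {V : Type*} [Fintype V] (F : SimpleGraph V) {s : ℕ}
    (hV : 2 ≤ Fintype.card V) (hs : ∀ k, 0 < k → k < Fintype.card V → k.Coprime s)
    (e : V ≃ Fin (Fintype.card V)) : (affineFamily F s e).ncard = s ^ 2 := by
  rw [affineFamily, Set.ncard_range_of_injective (affineCopy_toSubgraph_injective F hV hs e)]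
  simp [sq]

theorem affineFamily_isDecomposition {V : Type*} [Fintype V] (F : SimpleGraph V) {s : ℕ}
    (hs : ∀ k, 0 < k → k < Fintype.card V → k.Coprime s) (e : V ≃ Fin (Fintype.card V)) :
    IsDecomposition F (blowUp F s) (affineFamily F s e) := by
  refine ⟨⟨?_, ?_⟩, ?_⟩
  · rintro _ ⟨p, rfl⟩
    exact ⟨(affineCopy F s e p.1 p.2).isoToSubgraph⟩
  · rintro _ ⟨p, rfl⟩ _ ⟨q, rfl⟩ hne
    rw [Set.disjoint_left]
    intro d hp hq
    induction d using Sym2.ind with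
    | _ a b =>
    obtain ⟨hab, h1, h2⟩ := affineCopy_toSubgraph_adj.1 (SimpleGraph.Subgraph.mem_edgeSet.1 hp)
    obtain ⟨-, h3, h4⟩ := affineCopy_toSubgraph_adj.1 (SimpleGraph.Subgraph.mem_edgeSet.1 hq)
    apply hne
    rw [affineCoord_injective_of_ne hs (i := e a.1) (j := e b.1) (p := p) (q := q)
      (fun h => hab.ne (e.injective (Fin.ext h))) (e a.1).2 (e b.1).2
      (h1.trans h3.symm) (h2.trans h4.symm)]
  · intro d hd
    induction d using Sym2.ind with
    | _ a b =>
    have hab : F.Adj a.1 b.1 := hd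
    have hinj : Function.Injective fun p : Fin s × Fin s =>
        (affineCoord p.1 p.2 (e a.1), affineCoord p.1 p.2 (e b.1)) := by
      intro p q hpq
      exact affineCoord_injective_of_ne hs (fun h => hab.ne (e.injective (Fin.ext h)))
        (e a.1).2 (e b.1).2 (Prod.ext_iff.1 hpq).1 (Prod.ext_iff.1 hpq).2
    -- An injective map on the `s ^ 2` pairs is onto, so every edge between the two parts is
    -- covered.
    obtain ⟨p, hp⟩ := Finite.surjective_of_injective hinj (a.2, b.2)
    exact ⟨_, ⟨p, rfl⟩, SimpleGraph.Subgraph.mem_edgeSet.2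
      (affineCopy_toSubgraph_adj.2 ⟨hab, (Prod.ext_iff.1 hp).1, (Prod.ext_iff.1 hp).2⟩)⟩

/-! ### The lower bound. -/

theorem HasRainbowCopy.nonempty_hom {W U : Type*} {G : SimpleGraph W} {H : SimpleGraph U}
    {P : Set H.Subgraph} (h : HasRainbowCopy G P) : Nonempty (G →g unionGraph P) := by
  obtain ⟨f, c, hc⟩ := h
  exact ⟨⟨f, fun {a b} hab => ⟨_, (c ⟨s(a, b), hab⟩).2, hc ⟨s(a, b), hab⟩⟩⟩⟩

theorem le_multicolorTuran {V W : Type*} {F : SimpleGraph V} {G : SimpleGraph W} {n : ℕ}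
    {P : Set (⊤ : SimpleGraph (Fin n)).Subgraph} (hP : IsPacking F ⊤ P)
    (hG : ¬ HasRainbowCopy G P) : P.ncard ≤ multicolorTuran F G n := by
  refine le_csSup ⟨Nat.card (⊤ : SimpleGraph (Fin n)).Subgraph, ?_⟩ ⟨P, hP, hG, rfl⟩
  rintro k ⟨Q, -, -, rfl⟩
  exact Set.ncard_le_card Q

/-- The value 0 also arises as the supremum of the empty set: if `G` has no edges and at most `n`
vertices, even the empty family has a rainbow copy. -/
theorem multicolorTuran_eq_zero_or_exists {V W : Type*} (F : SimpleGraph V) (G : SimpleGraph W)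
    (n : ℕ) : multicolorTuran F G n = 0 ∨ ∃ P : Set (⊤ : SimpleGraph (Fin n)).Subgraph,
      IsPacking F ⊤ P ∧ ¬ HasRainbowCopy G P ∧ P.ncard = multicolorTuran F G n := by
  set S := {k : ℕ | ∃ P : Set (⊤ : SimpleGraph (Fin n)).Subgraph,
    IsPacking F ⊤ P ∧ ¬ HasRainbowCopy G P ∧ P.ncard = k} with hS
  rcases S.eq_empty_or_nonempty with h | h
  · left
    rw [multicolorTuran, ← hS, h, csSup_empty]
    rfl
  · right
    refine Nat.sSup_mem h ⟨Nat.card (⊤ : SimpleGraph (Fin n)).Subgraph, ?_⟩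
    rintro k ⟨Q, -, -, rfl⟩
    exact Set.ncard_le_card Q

theorem SimpleGraph.Subgraph.map_injective_of_injective {U U' : Type*} {H : SimpleGraph U}
    {K : SimpleGraph U'} (f : H →g K) (hf : Function.Injective f) :
    Function.Injective (SimpleGraph.Subgraph.map f) := by
  have hadj (A : H.Subgraph) (a b : U) : (A.map f).Adj (f a) (f b) ↔ A.Adj a b := by
    simp [SimpleGraph.Subgraph.map_adj, Relation.map_apply_apply hf hf]
  intro A B hAB
  ext a b
  · have : f a ∈ (A.map f).verts ↔ f a ∈ (B.map f).verts := by rw [hAB]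
    simpa [hf.eq_iff] using this
  · rw [← hadj A, ← hadj B, hAB]

theorem IsPacking.map {V U U' : Type*} {F : SimpleGraph V} {H : SimpleGraph U}
    {K : SimpleGraph U'} {P : Set H.Subgraph} (hP : IsPacking F H P) (f : SimpleGraph.Copy H K) :
    IsPacking F K (SimpleGraph.Subgraph.map f.toHom '' P) := by
  constructor
  · rintro _ ⟨A, hA, rfl⟩
    obtain ⟨φ⟩ := hP.isCopy A hA
    exact ⟨φ.trans (f.isoSubgraphMap A)⟩
  · rintro _ ⟨A, hA, rfl⟩ _ ⟨B, hB, rfl⟩ hne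
    rw [SimpleGraph.Subgraph.edgeSet_map, SimpleGraph.Subgraph.edgeSet_map,
      Set.disjoint_image_iff (Sym2.map.injective f.injective)]
    exact hP.edgeDisjoint hA hB fun h => hne (by rw [h])

/-- Without homomorphism from `G` to `F`, the affine family gives a packing of `m ^ 2` copies. -/
theorem sq_le_multicolorTuran {V W : Type*} [Fintype V] {F : SimpleGraph V}
    {G : SimpleGraph W} (hFG : IsEmpty (G →g F)) (hV : 2 ≤ Fintype.card V) {m n : ℕ}
    (hm : ∀ k, 0 < k → k < Fintype.card V → k.Coprime m) (hmn : Fintype.card V * m ≤ n) :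
    m ^ 2 ≤ multicolorTuran F G n := by
  rcases Nat.eq_zero_or_pos m with rfl | hm0
  · simp
  have : Nonempty V := Fintype.card_pos_iff.1 (by omega)
  have : NeZero m := ⟨hm0.ne'⟩
  have hcard : Fintype.card (V × Fin m) ≤ Fintype.card (Fin n) := by simpa using hmn
  obtain ⟨ι⟩ := Function.Embedding.nonempty_of_card_le hcard
  set f : SimpleGraph.Copy (blowUp F m) (⊤ : SimpleGraph (Fin n)) :=
    ⟨⟨ι, fun h => by simpa using h.ne⟩, ι.injective⟩ with hf
  set e := Fintype.equivFin V
  have hP := (affineFamily_isDecomposition F hm e).toIsPacking.map f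
  rw [← affineFamily_ncard F hV hm e, ← Set.ncard_image_of_injective (affineFamily F m e)
    (SimpleGraph.Subgraph.map_injective_of_injective f.toHom f.injective)]
  refine le_multicolorTuran hP fun hG => ?_
  obtain ⟨φ⟩ := hG.nonempty_hom
  -- A homomorphism to the embedded blow-up is pulled back along `ι` and projected to `F`.
  refine hFG.false ⟨fun w => (Function.invFun ι (φ w)).1, fun {a b} hab => ?_⟩
  obtain ⟨_, ⟨A, -, rfl⟩, hA⟩ := φ.map_adj hab
  obtain ⟨u, v, huv, hu, hv⟩ := hA
  have h1 : Function.invFun ι (φ a) = u := by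
    rw [← hu]; exact Function.leftInverse_invFun ι.injective u
  have h2 : Function.invFun ι (φ b) = v := by
    rw [← hv]; exact Function.leftInverse_invFun ι.injective v
  rw [h1, h2]
  exact A.adj_sub huv

theorem lower_bound {V W : Type*} [Fintype V] {F : SimpleGraph V}
    {G : SimpleGraph W} (hFG : IsEmpty (G →g F)) (hV : 2 ≤ Fintype.card V) {ε : ℝ} (hε : 0 < ε) :
    ∀ᶠ n : ℕ in atTop, (n : ℝ) ^ 2 / (Fintype.card V : ℝ) ^ 2 - ε * (n : ℝ) ^ 2 ≤
      multicolorTuran F G n := by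
  set t := Fintype.card V with ht
  have ht0 : 0 < t := by omega
  have htR : (0 : ℝ) < t := by exact_mod_cast ht0
  set C : ℝ := 1 + t.factorial with hC
  have hC0 : 0 < C := by positivity
  filter_upwards [eventually_ge_atTop t,
    tendsto_natCast_atTop_atTop.eventually_ge_atTop (C * t),
    tendsto_natCast_atTop_atTop.eventually_ge_atTop (2 * C / (t * ε))] with n hn hnC hnε
  -- The modulus `t! * q + 1` is coprime to every positive `k < t`, and this `q` is the largest that
  -- keeps it at most `n / t`. The loss against the real quotient is thus at most `C`, which costs
  -- at most `2 * C * (n / t)` after squaring.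
  set q := (n / t - 1) / t.factorial with hq
  have hfac : 0 < t.factorial := t.factorial_pos
  have hdiv : 1 ≤ n / t := (Nat.one_le_div_iff ht0).2 hn
  have hm_le : t.factorial * q + 1 ≤ n / t := by
    have := Nat.mul_div_le (n / t - 1) t.factorial
    rw [← hq] at this
    omega
  have hm_ge : n / t < t.factorial * q + 1 + t.factorial := by
    have := Nat.lt_mul_div_succ (n / t - 1) hfac
    rw [← hq, mul_add, mul_one] at this
    omega
  have hcop : ∀ k, 0 < k → k < t → k.Coprime (t.factorial * q + 1) := by
    intro k hk hkt
    obtain ⟨r, hr⟩ := Nat.dvd_factorial hk hkt.le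
    rw [hr, mul_assoc]
    simp
  have h1 := sq_le_multicolorTuran hFG hV hcop
    ((Nat.mul_le_mul_left t hm_le).trans (Nat.mul_div_le n t))
  have h2 : (n : ℝ) / t - C ≤ (t.factorial * q + 1 : ℕ) := by
    have h3 : (n : ℝ) / t < (n / t : ℕ) + 1 := by
      rw [div_lt_iff₀ htR]
      have := Nat.lt_mul_div_succ n ht0
      rw [mul_comm]
      exact_mod_cast this
    have h4 : ((n / t : ℕ) : ℝ) ≤ (t.factorial * q + 1 : ℕ) + t.factorial := by
      exact_mod_cast hm_ge.le
    linarith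
  have h5 : 0 ≤ (n : ℝ) / t - C := by
    rw [sub_nonneg, le_div_iff₀ htR]; exact hnC
  have h6 : ((n : ℝ) / t - C) ^ 2 ≤ ((t.factorial * q + 1 : ℕ) : ℝ) ^ 2 := by gcongr
  have h7 : (((t.factorial * q + 1 : ℕ) : ℝ)) ^ 2 ≤ multicolorTuran F G n := by
    exact_mod_cast h1
  refine le_trans ?_ (h6.trans h7)
  have h8 : 2 * C * (n / t : ℝ) ≤ ε * (n : ℝ) ^ 2 := by
    rw [div_le_iff₀ (by positivity)] at hnε
    rw [← mul_div_assoc, div_le_iff₀ htR]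
    nlinarith [(Nat.cast_nonneg n : (0 : ℝ) ≤ n)]
  have h9 : ((n : ℝ) / t - C) ^ 2 = (n : ℝ) ^ 2 / (t : ℝ) ^ 2 - 2 * C * (n / t : ℝ) + C ^ 2 := by
    rw [sub_sq, div_pow]; ring
  rw [h9]
  nlinarith [sq_nonneg C]

/-! ### Refinement of packings. -/

/-- Refining the members of a packing of `F'` by a packing of `F` in `F'`. -/
theorem IsPacking.exists_refinement {V V' U : Type*} {F : SimpleGraph V} {F' : SimpleGraph V'}
    {H : SimpleGraph U} {D : Set F'.Subgraph} {Q : Set H.Subgraph} (hD : IsPacking F F' D)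
    (hQ : IsPacking F' H Q) (hF : ∃ a b, F.Adj a b) :
    ∃ R : Set H.Subgraph, IsPacking F H R ∧ R.ncard = Q.ncard * D.ncard ∧
      unionGraph R ≤ unionGraph Q := by
  have hex : ∀ A : Q, ∃ g : SimpleGraph.Copy F' H,
      ∀ a b, F'.Adj a b → A.1.Adj (g.toHom a) (g.toHom b) := by
    rintro ⟨A, hA⟩
    obtain ⟨φ⟩ := hQ.isCopy A hA
    exact ⟨(SimpleGraph.Subgraph.coeCopy A).comp φ.toCopy,
      fun a b hab => (φ.map_adj_iff.2 hab : A.coe.Adj (φ a) (φ b))⟩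
  choose g hg using hex
  set r : Q × D → H.Subgraph := fun p => p.2.1.map (g p.1).toHom with hr
  have hle (p : Q × D) {u v : U} (h : (r p).Adj u v) : p.1.1.Adj u v := by
    obtain ⟨a, b, hab, rfl, rfl⟩ := h
    exact hg p.1 a b hab.adj_sub
  have hadj {p q : Q × D} {u v : U} (hp : (r p).Adj u v) (hq : (r q).Adj u v) : p = q := by
    obtain ⟨A, B⟩ := p
    obtain ⟨A', B'⟩ := q
    obtain rfl : A = A' := Subtype.ext (hQ.eq_of_adj A.2 A'.2 (hle _ hp) (hle _ hq))
    obtain ⟨a, b, hab, rfl, rfl⟩ := hp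
    obtain ⟨a', b', hab', ha, hb⟩ := hq
    obtain rfl := (g A).injective ha
    obtain rfl := (g A).injective hb
    obtain rfl : B = B' := Subtype.ext (hD.eq_of_adj B.2 B'.2 hab hab')
    rfl
  -- An edge in every piece makes pieces with different indices distinct; edgeless pieces could
  -- coincide and spoil the count.
  have hedge (p : Q × D) : ∃ u v, (r p).Adj u v := by
    obtain ⟨a, b, hab⟩ := hF
    obtain ⟨φ⟩ := hD.isCopy p.2.1 p.2.2
    have h : p.2.1.coe.Adj (φ a) (φ b) := φ.map_adj_iff.2 hab
    exact ⟨_, _, _, _, h, rfl, rfl⟩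
  have hinj : Function.Injective r := by
    intro p q hpq
    obtain ⟨u, v, h⟩ := hedge p
    exact hadj h (hpq ▸ h)
  refine ⟨Set.range r, ⟨?_, ?_⟩, ?_, ?_⟩
  · rintro _ ⟨p, rfl⟩
    obtain ⟨φ⟩ := hD.isCopy p.2.1 p.2.2
    exact ⟨φ.trans ((g p.1).isoSubgraphMap p.2.1)⟩
  · rintro _ ⟨p, rfl⟩ _ ⟨q, rfl⟩ hne
    rw [Set.disjoint_left]
    intro d hp hq
    induction d using Sym2.ind with
    | _ u v => exact hne (by rw [hadj (u := u) (v := v) hp hq])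
  · rw [Set.ncard_range_of_injective hinj, Nat.card_prod, Nat.card_coe_set_eq,
      Nat.card_coe_set_eq]
  · rintro u v ⟨_, ⟨p, rfl⟩, h⟩
    exact ⟨p.1.1, p.1.2, hle p h⟩

/-! ### Consequences of attaining the lower bound. -/

theorem attainsLowerBound_iff {V W : Type*} [Fintype V] {F : SimpleGraph V} {G : SimpleGraph W} :
    AttainsLowerBound F G ↔ ∀ ε : ℝ, 0 < ε → ∀ᶠ n : ℕ in atTop,
      |(multicolorTuran F G n : ℝ) - (n : ℝ) ^ 2 / (Fintype.card V : ℝ) ^ 2| ≤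
        ε * (n : ℝ) ^ 2 := by
  simp [AttainsLowerBound, isLittleO_iff]

/-- An optimal packing has about `n ^ 2 / v(F) ^ 2` members, so one survives the cleaning. A
homomorphism from `G` to `F` would then map `G` into that member, and so into the cleaned union. -/
theorem AttainsLowerBound.isEmpty_hom {V W : Type*} [Fintype V] [Nonempty V] [Fintype W]
    {F : SimpleGraph V} {G : SimpleGraph W} (h : AttainsLowerBound F G) : IsEmpty (G →g F) := by
  have ht : (0 : ℝ) < (Fintype.card V : ℝ) := by exact_mod_cast Fintype.card_pos
  -- The main term is `4 * ε * n ^ 2`; the asymptotic error and the cleaning cost at most `ε * n ^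
  -- 2` each.
  set ε : ℝ := 1 / (4 * (Fintype.card V : ℝ) ^ 2) with hε
  have hε0 : 0 < ε := by positivity
  obtain ⟨n, hn, hclean, hn0⟩ := ((attainsLowerBound_iff.1 h ε hε0).and
    ((exists_subpacking_hom_free F G hε0).and (eventually_gt_atTop 0))).exists
  have hn0' : (0 : ℝ) < n := by exact_mod_cast hn0
  have h1 : (n : ℝ) ^ 2 / (Fintype.card V : ℝ) ^ 2 = 4 * (ε * (n : ℝ) ^ 2) := by
    rw [hε]; field_simp
  have h2 : 0 < ε * (n : ℝ) ^ 2 := by positivity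
  rw [h1] at hn
  have h3 := (abs_le.1 hn).1
  rcases multicolorTuran_eq_zero_or_exists F G n with h0 | ⟨P, hP, hG, hPn⟩
  · rw [h0] at h3
    push_cast at h3
    linarith
  obtain ⟨P', hP', hempty, hle⟩ := hclean P hP hG
  rw [hPn] at hle
  have hpos : (0 : ℝ) < P'.ncard := by linarith
  obtain ⟨A, hA⟩ := (Set.ncard_pos).1 (by exact_mod_cast hpos : 0 < P'.ncard)
  obtain ⟨φ⟩ := hP.isCopy A (hP' hA)
  refine ⟨fun ψ => hempty.false ⟨fun w => (φ (ψ w) : Fin n), fun {a b} hab => ⟨A, hA, ?_⟩⟩⟩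
  exact (φ.map_adj_iff.2 (ψ.map_adj hab) : A.coe.Adj (φ (ψ a)) (φ (ψ b)))

/-- If `F` has no edges, then every set of `v(F)` vertices carries a copy of `F`. -/
theorem choose_le_multicolorTuran {V W : Type*} [Fintype V] {F : SimpleGraph V}
    {G : SimpleGraph W} (hF : ∀ a b, ¬ F.Adj a b) (hG : ∃ a b, G.Adj a b) (n : ℕ) :
    n.choose (Fintype.card V) ≤ multicolorTuran F G n := by
  set r : {S : Finset (Fin n) // S.card = Fintype.card V} → (⊤ : SimpleGraph (Fin n)).Subgraph :=
    fun S => { verts := ↑S.1, Adj := fun _ _ => False, adj_sub := False.elim,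
               edge_vert := False.elim, symm := ⟨fun _ _ h => h⟩ } with hr
  have hinj : Function.Injective r := fun S T hST =>
    Subtype.ext (Finset.coe_injective (congrArg SimpleGraph.Subgraph.verts hST))
  have hedge (S) (d : Sym2 (Fin n)) : d ∉ (r S).edgeSet := by
    induction d using Sym2.ind with
    | _ u v => exact fun h => h
  have hcard : (Set.range r).ncard = n.choose (Fintype.card V) := by
    rw [Set.ncard_range_of_injective hinj, Nat.card_eq_fintype_card, Fintype.card_finset_len,
      Fintype.card_fin]
  rw [← hcard]
  refine le_multicolorTuran ⟨?_, ?_⟩ ?_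
  · rintro _ ⟨S, rfl⟩
    have hS : Fintype.card V = Fintype.card S.1 := by rw [Fintype.card_coe, S.2]
    exact ⟨⟨Fintype.equivOfCardEq hS, fun {a b} => ⟨False.elim, fun h => hF a b h⟩⟩⟩
  · rintro _ ⟨S, rfl⟩ _ _ _
    exact Set.disjoint_left.2 fun d hd => absurd hd (hedge S d)
  · rintro ⟨f, c, hc⟩
    obtain ⟨a, b, hab⟩ := hG
    obtain ⟨S, hS⟩ := (c ⟨s(a, b), hab⟩).2
    exact hedge S _ (hS ▸ hc ⟨s(a, b), hab⟩)

theorem multicolorTuran_le_of_card_eq_one {V W : Type*} [Fintype V] {F : SimpleGraph V}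
    {G : SimpleGraph W} (hV : Fintype.card V = 1) (n : ℕ) : multicolorTuran F G n ≤ n := by
  rcases multicolorTuran_eq_zero_or_exists F G n with h0 | ⟨P, hP, -, hPn⟩
  · omega
  rw [← hPn]
  have hverts (A) (hA : A ∈ P) : ∃ x, A.verts = {x} := by
    obtain ⟨φ⟩ := hP.isCopy A hA
    rw [← Set.ncard_eq_one, ← Nat.card_coe_set_eq, ← Nat.card_congr φ.toEquiv,
      Nat.card_eq_fintype_card, hV]
  have hinj : Set.InjOn SimpleGraph.Subgraph.verts P := by
    intro A hA B hB hAB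
    obtain ⟨x, hx⟩ := hverts A hA
    have hno {C : (⊤ : SimpleGraph (Fin n)).Subgraph} (hC : C.verts = {x}) (u v : Fin n) :
        ¬ C.Adj u v := by
      intro h
      have h1 := C.edge_vert h
      have h2 := C.edge_vert h.symm
      rw [hC, Set.mem_singleton_iff] at h1 h2
      exact h.ne (h1.trans h2.symm)
    ext u v
    · rw [hAB]
    · exact iff_of_false (hno hx u v) (hno (hAB ▸ hx) u v)
  calc P.ncard ≤ (Set.range fun x : Fin n => ({x} : Set (Fin n))).ncard := by
        refine Set.ncard_le_ncard_of_injOn _ (fun A hA => ?_) hinj (Set.toFinite _)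
        obtain ⟨x, hx⟩ := hverts A hA
        exact ⟨x, hx.symm⟩
    _ = n := by
        rw [Set.ncard_range_of_injective Set.singleton_injective]
        simp

theorem choose_two_le_choose {n t : ℕ} (ht : 2 ≤ t) (htn : 2 * t ≤ n) :
    n.choose 2 ≤ n.choose t := by
  induction t, ht using Nat.le_induction with
  | base => rfl
  | succ k hk ih =>
    exact (ih (by omega)).trans (Nat.choose_le_succ_of_lt_half_left (by omega))

/-- An edgeless `F` has the wrong order of growth or the wrong constant: at most `n` copies if `v(F)
= 1`, and otherwise at least `n.choose 2`, which exceeds `(1 / 4 + 1 / 8) * n ^ 2` for `n > 4`. -/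
theorem AttainsLowerBound.exists_adj {V W : Type*} [Fintype V] [Nonempty V] [Fintype W]
    {F : SimpleGraph V} {G : SimpleGraph W} (h : AttainsLowerBound F G) : ∃ a b, F.Adj a b := by
  by_contra! hF
  have hG : ∃ a b, G.Adj a b := by
    by_contra! hG
    exact h.isEmpty_hom.false ⟨fun _ => Classical.arbitrary V, fun {a b} hab => (hG a b hab).elim⟩
  obtain ⟨n, hn, hnt, hn4⟩ := ((attainsLowerBound_iff.1 h (1 / 8) (by norm_num)).and
    ((eventually_ge_atTop (2 * Fintype.card V)).and (eventually_gt_atTop 4))).exists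
  have hn4' : (4 : ℝ) < n := by exact_mod_cast hn4
  obtain ⟨h1, h2⟩ := abs_le.1 hn
  have ht : 0 < Fintype.card V := Fintype.card_pos
  obtain ht1 | ht2 : Fintype.card V = 1 ∨ 2 ≤ Fintype.card V := by omega
  · have h3 : (multicolorTuran F G n : ℝ) ≤ n := by
      exact_mod_cast multicolorTuran_le_of_card_eq_one ht1 n
    rw [ht1] at h1
    norm_num at h1
    nlinarith
  · have h3 : ((n.choose 2 : ℕ) : ℝ) ≤ multicolorTuran F G n := by
      exact_mod_cast (choose_two_le_choose ht2 hnt).trans (choose_le_multicolorTuran hF hG n)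
    rw [Nat.cast_choose_two] at h3
    have h4 : (n : ℝ) ^ 2 / (Fintype.card V : ℝ) ^ 2 ≤ (n : ℝ) ^ 2 / 2 ^ 2 := by
      gcongr
      exact_mod_cast ht2
    nlinarith

/-! ### The upper bound and the conclusion. -/

/-- Cleaning has to precede refinement: a rainbow `G` in the refined family may use several pieces
of one copy of `F'`, so rainbow-freeness alone need not survive, whereas the absence of
homomorphisms to the union does. -/
theorem upper_bound {V V' W : Type*} [Fintype V] [Fintype V'] [Fintype W]
    {F : SimpleGraph V} {F' : SimpleGraph V'} {G : SimpleGraph W} {m : ℕ} (hm : 0 < m)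
    (hF : ∃ a b, F.Adj a b) (h : AttainsLowerBound F G) (hD : DecomposesInto F' m F) {ε : ℝ}
    (hε : 0 < ε) : ∀ᶠ n : ℕ in atTop, (multicolorTuran F' G n : ℝ) ≤
      (n : ℝ) ^ 2 / (Fintype.card V : ℝ) ^ 2 / m + ε * (n : ℝ) ^ 2 := by
  obtain ⟨D, -, hDm, hD⟩ := hD
  have hm' : (1 : ℝ) ≤ m := by exact_mod_cast hm
  filter_upwards [attainsLowerBound_iff.1 h (ε / 2) (by positivity),
    exists_subpacking_hom_free F' G (half_pos hε)] with n hn hclean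
  rcases multicolorTuran_eq_zero_or_exists F' G n with h0 | ⟨P, hP, hG, hPn⟩
  · rw [h0]
    push_cast
    positivity
  obtain ⟨P', hP', hempty, hle⟩ := hclean P hP hG
  have hpack : IsPacking F' ⊤ P' :=
    ⟨fun A hA => hP.isCopy A (hP' hA), hP.edgeDisjoint.mono hP'⟩
  obtain ⟨R, hR, hRcard, hRle⟩ := hD.toIsPacking.exists_refinement hpack hF
  have h1 : R.ncard ≤ multicolorTuran F G n := by
    refine le_multicolorTuran hR fun hrb => ?_
    obtain ⟨φ⟩ := hrb.nonempty_hom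
    exact hempty.false ((SimpleGraph.Hom.ofLE hRle).comp φ)
  rw [hRcard, hDm] at h1
  have h2 : (P'.ncard : ℝ) * m ≤ multicolorTuran F G n := by exact_mod_cast h1
  have h3 := (abs_le.1 hn).2
  rw [hPn] at hle
  have h4 : (P'.ncard : ℝ) ≤
      ((n : ℝ) ^ 2 / (Fintype.card V : ℝ) ^ 2 + ε / 2 * (n : ℝ) ^ 2) / m := by
    rw [le_div_iff₀ (by positivity)]
    linarith
  rw [add_div] at h4
  have h5 : ε / 2 * (n : ℝ) ^ 2 / m ≤ ε / 2 * (n : ℝ) ^ 2 := div_le_self (by positivity) hm'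
  linarith

theorem AttainsLowerBound.blowUp {V W : Type*} [Fintype V] [Nonempty V] [Fintype W]
    {F : SimpleGraph V} {G : SimpleGraph W} {s : ℕ} (hs : 0 < s) (h : AttainsLowerBound F G)
    (hD : DecomposesInto (blowUp F s) (s ^ 2) F) : AttainsLowerBound (blowUp F s) G := by
  obtain ⟨a, b, hab⟩ := h.exists_adj
  have hV : 2 ≤ Fintype.card V := Fintype.one_lt_card_iff.2 ⟨a, b, hab.ne⟩
  have hcard : Fintype.card (V × Fin s) = Fintype.card V * s := by simp
  have hhom : IsEmpty (G →g _root_.blowUp F s) :=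
    ⟨fun φ => h.isEmpty_hom.false ⟨fun w => (φ w).1, fun {a b} hab => φ.map_adj hab⟩⟩
  rw [attainsLowerBound_iff]
  intro ε hε
  filter_upwards [lower_bound hhom (by rw [hcard]; nlinarith) hε,
    upper_bound (by positivity) ⟨a, b, hab⟩ h hD hε] with n hlow hup
  have heq : (n : ℝ) ^ 2 / (Fintype.card V : ℝ) ^ 2 / ((s ^ 2 : ℕ) : ℝ) =
      (n : ℝ) ^ 2 / (Fintype.card (V × Fin s) : ℝ) ^ 2 := by
    rw [hcard, div_div]
    push_cast
    rw [mul_pow]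
  rw [heq] at hup
  rw [abs_le]
  constructor <;> linarith

theorem mainTheorem6 {V W : Type*} [Fintype V] [Nonempty V] [Fintype W]
    (F : SimpleGraph V) (G : SimpleGraph W) (s : ℕ) (hs : 0 < s) :
    (AttainsLowerBound F G → DecomposesInto (blowUp F s) (s ^ 2) F →
      AttainsLowerBound (blowUp F s) G) ∧
    (s.Prime → Fintype.card V ≤ s →
      (AttainsLowerBound F G → AttainsLowerBound (blowUp F s) G) ∧
      (2 ≤ Fintype.card V →
        DecomposesInto (blowUp F s) (s ^ 2) F ∧
        ∀ e : V ≃ Fin (Fintype.card V),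
          IsDecomposition F (blowUp F s) (affineFamily F s e) ∧
          (affineFamily F s e).ncard = s ^ 2)) := by
  refine ⟨fun h hD => h.blowUp hs hD, fun hp hVs => ?_⟩
  have hcop : ∀ k, 0 < k → k < Fintype.card V → k.Coprime s := fun k hk hkV =>
    (Nat.coprime_of_lt_prime hk.ne' (hkV.trans_le hVs) hp).symm
  have hdec (hV : 2 ≤ Fintype.card V) : DecomposesInto (blowUp F s) (s ^ 2) F :=
    ⟨affineFamily F s (Fintype.equivFin V), Set.finite_range _, affineFamily_ncard F hV hcop _,
      affineFamily_isDecomposition F hcop _⟩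
  refine ⟨fun h => h.blowUp hs (hdec ?_), fun hV => ⟨hdec hV, fun e =>
    ⟨affineFamily_isDecomposition F hcop e, affineFamily_ncard F hV hcop e⟩⟩⟩
  obtain ⟨a, b, hab⟩ := h.exists_adj
  exact Fintype.one_lt_card_iff.2 ⟨a, b, hab.ne⟩
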